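/- Let $G$ be a finite connected graph with at least one edge (loops and multiple edges allowed), embedded in the oriented torus $\mathbb T$ so that every face is a topological disk. **The graph $G^\square$.** Replace every edge $e$ of $G$ by a small square with two sides crossing $e$ and two sides parallel to $e$. Colour its corners so that, looking along $e$ from either of its endpoints, the nearer left corner is black and the nearer right corner is white. Around each vertex of $G$, for any two half-edges $d,d'$ with $d'$ the next one counterclockwise after $d$, join the near left (black) corner of the square at $d$ to the near right (white) corner of the square at $d'$ by an edge. The result $G^\square$ is a trivalent bipartite graph in $\mathbb T$ with one square face for each edge of $G$. **Weights.** A positive edge weight on a bipartite graph $\Gamma$ is a function $\mathrm{wt}:E(\Gamma)\to\mathbb R_{>0}$. Two weights are gauge equivalent if $\mathrm{wt}'(\{b,w\})=f(b)^{-1}\,\mathrm{wt}(\{b,w\})\,f(w)$ for all edges $\{b,w\}$ ($b$ black, $w$ white), for some function $f$ from the vertices to $\mathbb R_{>0}$. Let $\mathcal X_\Gamma(\mathbb R_{>0})$ be the set of gauge classes $[\mathrm{wt}]$. An Ising model on $G$ is a function $J:E(G)\to\mathbb R_{>0}$; let $\mathcal I_G(\mathbb R_{>0})$ be the set of all of them.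 It defines the weight $\mathrm{wt}^\square_J$ on $G^\square$ that is $s_e=\operatorname{sech}(2J_e)$ on the two sides of the square of $e$ crossing $e$, $c_e=\tanh(2J_e)$ on the two sides parallel to $e$, and $1$ on the edges joining squares. **Square move.** Consider a square face of a bipartite graph whose two black corners are distinct and trivalent. By a gauge transformation at these corners, give their two edges that are not sides of the square the weight $1$; let $a,b,c,d$ be the weights of the sides in cyclic order. The square move deletes the two black corners and their six edges and puts in a new square in the same place with colours of corners interchanged: each new black corner, at the place of an old white corner of the square, is joined by an edge of weight $1$ to that old white vertex, while the new white corners are the white vertices to which the old black corners were joined outside the square. Each side of the new square has weight equal to the weight of the opposite side of the old square divided by $ac+bd$. Performing square moves at the square faces of $G^\square$ corresponding to all edges of $G$, one after the other in any order, gives the graph $\overline{G^\square}$, which is $G^\square$ with the colours of all vertices interchanged, and a well-defined map $\mu:\mathcal X_{G^\square}(\mathbb R_{>0})\to\mathcal X_{\overline{G^\square}}(\mathbb R_{>0})$. For $[\mathrm{wt}]\in\mathcal X_{G^\square}(\mathbb R_{>0})$, let $[\overline{\mathrm{wt}}]\in\mathcal X_{\overline{G^\square}}(\mathbb R_{>0})$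 be the class of the weight with the same value as $\mathrm{wt}$ on every edge. **Theorem.** The map $J\mapsto[\mathrm{wt}^\square_J]$ from $\mathcal I_G(\mathbb R_{>0})$ to $\mathcal X_{G^\square}(\mathbb R_{>0})$ is injective, and its image is exactly $$\{[\mathrm{wt}]\in\mathcal X_{G^\square}(\mathbb R_{>0}) : \mu([\mathrm{wt}])=[\overline{\mathrm{wt}}]\}.$$ -/

import Mathlib

/-- The positive real numbers. -/
abbrev PosReal : Type := {x : ℝ // 0 < x}

/-- A finite graph (loops and multiple edges allowed) embedded in the oriented torus so that every
face is a topological disk, presented by its rotation system.  `D` is the set of oriented edges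
(darts), a dart being based at its initial vertex; `next` sends a dart to the next one
counterclockwise around its base vertex, and `rev` reverses the orientation of a dart.  Vertices,
edges and faces are the orbits of `next`, of `rev`, and of `next⁻¹ * rev` (the next dart when one
walks along the boundary with the face on the left).  The surface is the torus because the graph
is connected and the Euler characteristic `V - E + F` is zero. -/
structure TorusGraph (D : Type*) where
  next : Equiv.Perm D
  rev : Equiv.Perm D
  rev_rev : ∀ d, rev (rev d) = d
  rev_ne : ∀ d, rev d ≠ d
  finite : Finite D
  nonempty : Nonempty D
  connected : ∀ d d' : D, ∃ g ∈ Subgroup.closure {next, rev}, g d = d'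
  euler : Nat.card (Quotient (Equiv.Perm.SameCycle.setoid next)) +
      Nat.card (Quotient (Equiv.Perm.SameCycle.setoid (next⁻¹ * rev))) =
    Nat.card (Quotient (Equiv.Perm.SameCycle.setoid rev))

namespace TorusGraph

/-- The set of (unoriented) edges `E(G)`. -/
def Edge {D : Type*} (G : TorusGraph D) : Type _ :=
  Quotient (Equiv.Perm.SameCycle.setoid G.rev)

/-- The unoriented edge underlying a dart. -/
def edge {D : Type*} (G : TorusGraph D) (d : D) : G.Edge :=
  Quotient.mk (Equiv.Perm.SameCycle.setoid G.rev) d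

end TorusGraph

/-- A bipartite graph (multiple edges allowed) with edge set `E`, cellularly embedded in an
oriented surface, presented by its rotation system: `black` (resp. `white`) sends an edge to the
next edge counterclockwise around its black (resp. white) endpoint. -/
@[ext]
structure BipartiteMap (E : Type*) where
  black : Equiv.Perm E
  white : Equiv.Perm E

namespace BipartiteMap

/-- The set of black vertices. -/
def Black {E : Type*} (Γ : BipartiteMap E) : Type _ :=
  Quotient (Equiv.Perm.SameCycle.setoid Γ.black)

/-- The set of white vertices. -/
def White {E : Type*} (Γ : BipartiteMap E) : Type _ :=
  Quotient (Equiv.Perm.SameCycle.setoid Γ.white)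

/-- The black endpoint of an edge. -/
def blackEnd {E : Type*} (Γ : BipartiteMap E) (e : E) : Γ.Black :=
  Quotient.mk (Equiv.Perm.SameCycle.setoid Γ.black) e

/-- The white endpoint of an edge. -/
def whiteEnd {E : Type*} (Γ : BipartiteMap E) (e : E) : Γ.White :=
  Quotient.mk (Equiv.Perm.SameCycle.setoid Γ.white) e

/-- Gauge equivalence of positive edge weights: `wt' e = f(b)⁻¹ wt(e) f(w)` for every edge `e`
with black endpoint `b` and white endpoint `w`. -/
def GaugeEquiv {E : Type*} (Γ : BipartiteMap E) (wt wt' : E → PosReal) : Prop :=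
  ∃ (f : Γ.Black → PosReal) (g : Γ.White → PosReal),
    ∀ e, wt' e = (f (Γ.blackEnd e))⁻¹ * wt e * g (Γ.whiteEnd e)

theorem gaugeEquiv_iff {E : Type*} (Γ : BipartiteMap E) (wt wt' : E → PosReal) :
    Γ.GaugeEquiv wt wt' ↔ ∃ p q : E → PosReal, (∀ e, p (Γ.black e) = p e) ∧
      (∀ e, q (Γ.white e) = q e) ∧ ∀ e, wt' e = (p e)⁻¹ * wt e * q e := by
  constructor
  · rintro ⟨f, g, h⟩
    refine ⟨fun e => f (Γ.blackEnd e), fun e => g (Γ.whiteEnd e), fun e => ?_, fun e => ?_, h⟩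
    · exact congrArg f (Quotient.sound
        (Equiv.Perm.sameCycle_apply_left.2 (Equiv.Perm.SameCycle.refl _ _)))
    · exact congrArg g (Quotient.sound
        (Equiv.Perm.sameCycle_apply_left.2 (Equiv.Perm.SameCycle.refl _ _)))
  · rintro ⟨p, q, hp, hq, h⟩
    have key : ∀ (π : Equiv.Perm E) (r : E → PosReal), (∀ e, r (π e) = r e) →
        ∀ x y, π.SameCycle x y → r x = r y := by
      intro π r hr x y ⟨n, hn⟩
      have hinv : ∀ e, r (π⁻¹ e) = r e := fun e => by
        have := hr (π⁻¹ e)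
        simpa using this.symm
      have hz : ∀ n : ℤ, ∀ e, r ((π ^ n) e) = r e := by
        intro n
        induction n using Int.induction_on with
        | zero => intro e; simp
        | succ k ih => intro e; rw [zpow_add_one, Equiv.Perm.mul_apply, ih, hr]
        | pred k ih => intro e; rw [zpow_sub_one, Equiv.Perm.mul_apply, ih, hinv]
      rw [← hn, hz]
    exact ⟨Quotient.lift p (key _ p hp), Quotient.lift q (key _ q hq), h⟩

/-- Gauge equivalence is an equivalence relation. -/
def gaugeSetoid {E : Type*} (Γ : BipartiteMap E) : Setoid (E → PosReal) where
  r := Γ.GaugeEquiv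
  iseqv := by
    refine ⟨fun wt => ⟨fun _ => 1, fun _ => 1, fun e => by simp⟩, ?_, ?_⟩
    · rintro wt wt' ⟨f, g, h⟩
      refine ⟨fun v => (f v)⁻¹, fun v => (g v)⁻¹, fun e => ?_⟩
      rw [h e]; simp [mul_assoc]
    · rintro wt wt' wt'' ⟨f, g, h⟩ ⟨f', g', h'⟩
      refine ⟨fun v => f v * f' v, fun v => g v * g' v, fun e => ?_⟩
      rw [h' e, h e]; simp [mul_assoc, mul_comm, mul_left_comm]

/-- The set of positive edge weights modulo gauge equivalence. -/
def X {E : Type*} (Γ : BipartiteMap E) : Type _ := Quotient Γ.gaugeSetoid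

/-- The class `[wt]` of an edge weight. -/
def weightClass {E : Type*} (Γ : BipartiteMap E) (wt : E → PosReal) : Γ.X :=
  Quotient.mk Γ.gaugeSetoid wt

/-- The same embedded graph with the colours of all vertices changed. -/
def colorSwap {E : Type*} (Γ : BipartiteMap E) : BipartiteMap E := ⟨Γ.white, Γ.black⟩

/-- `[wt] ↦ [wt‾]`: change all colours and keep the weight of every edge. -/
def colorSwapX {E : Type*} (Γ : BipartiteMap E) : Γ.X → Γ.colorSwap.X :=
  Quotient.map' (s₁ := Γ.gaugeSetoid) (s₂ := Γ.colorSwap.gaugeSetoid) id (by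
    rintro wt wt' ⟨f, g, h⟩
    refine ⟨fun v => (g v)⁻¹, fun v => (f v)⁻¹, fun e => ?_⟩
    change wt' e = (g (Γ.whiteEnd e))⁻¹⁻¹ * wt e * (f (Γ.blackEnd e))⁻¹
    rw [h e, inv_inv, mul_assoc (g _), mul_comm (wt e) (f _)⁻¹, mul_comm])

/-- An isomorphism of embedded bipartite graphs: a bijection of the edges that respects both
rotations (hence vertices, colours, faces and orientation). -/
structure Iso {E E' : Type*} (Γ : BipartiteMap E) (Γ' : BipartiteMap E') where
  toEquiv : E ≃ E'
  black : ∀ e, Γ'.black (toEquiv e) = toEquiv (Γ.black e)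
  white : ∀ e, Γ'.white (toEquiv e) = toEquiv (Γ.white e)

/-- Transport of weight classes along an isomorphism. -/
def Iso.mapX {E E' : Type*} {Γ : BipartiteMap E} {Γ' : BipartiteMap E'} (i : Γ.Iso Γ') :
    Γ.X → Γ'.X :=
  Quotient.map' (s₁ := Γ.gaugeSetoid) (s₂ := Γ'.gaugeSetoid) (fun wt e => wt (i.toEquiv.symm e)) (by
    intro wt wt' h
    obtain ⟨p, q, hp, hq, h⟩ := (gaugeEquiv_iff Γ _ _).1 h
    refine (gaugeEquiv_iff Γ' _ _).2 ⟨fun e => p (i.toEquiv.symm e),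
      fun e => q (i.toEquiv.symm e), fun e => ?_, fun e => ?_, fun e => h _⟩
    · obtain ⟨e, rfl⟩ := i.toEquiv.surjective e
      simp [i.black, hp]
    · obtain ⟨e, rfl⟩ := i.toEquiv.surjective e
      simp [i.white, hq])

/-! ### The square move

Let `e` be an edge for which the face on the left of `e` (walked from black to white) is a square.
Its sides in counterclockwise order are `e = side₁`, `side₂`, `side₃`, `side₄`; when the two black
corners are trivalent, their third edges are `leg₁` (at the corner of `side₄` and `side₁`) and
`leg₂` (at the corner of `side₂` and `side₃`).  With the black corners drawn at the north-west and
the south-east, the sides 1, 2, 3, 4 are left, bottom, right, top. -/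

def side₂ {E : Type*} (Γ : BipartiteMap E) (e : E) : E := Γ.white⁻¹ e
def side₃ {E : Type*} (Γ : BipartiteMap E) (e : E) : E := Γ.black⁻¹ (Γ.side₂ e)
def side₄ {E : Type*} (Γ : BipartiteMap E) (e : E) : E := Γ.white⁻¹ (Γ.side₃ e)
def leg₁ {E : Type*} (Γ : BipartiteMap E) (e : E) : E := Γ.black⁻¹ e
def leg₂ {E : Type*} (Γ : BipartiteMap E) (e : E) : E := Γ.black⁻¹ (Γ.side₃ e)

/-- The face on the left of `e` is a square whose two black corners are distinct and trivalent, so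
that the square move can be performed at it. -/
structure IsSquareFace {E : Type*} (Γ : BipartiteMap E) (e : E) : Prop where
  closes : Γ.black⁻¹ (Γ.side₄ e) = e
  trivalent₁ : Γ.black (Γ.side₄ e) = Γ.leg₁ e
  trivalent₂ : Γ.black (Γ.side₂ e) = Γ.leg₂ e
  nodup : [e, Γ.side₂ e, Γ.side₃ e, Γ.side₄ e, Γ.leg₁ e, Γ.leg₂ e].Nodup

/-- The embedded graph obtained by the square move at the square face on the left of `e`.
The four sides keep their names and their positions.  The black corners move by a quarter turn,
from the north-west to the south-west and from the south-east to the north-east, and take the names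
of their legs with them.  At the old white corners, the two consecutive sides (`side₂` followed
by `side₁` at the south-west, `side₄` followed by `side₃` at the north-east) are replaced by the
new leg (`leg₁`, resp. `leg₂`); at the white end of an old leg, that leg (`leg₁`, resp. `leg₂`) is
replaced by two consecutive sides (`side₁` followed by `side₄`, resp. `side₃` followed by `side₂`).
In the formula for `white`, the factor `contract` deletes `e` and `side₃` from their cycles, so that
only one symbol is left at each old white corner; conjugation by `relabel` renames `side₂, leg₁` to
`leg₁, e` and `side₄, leg₂` to `leg₂, side₃`; the factor `expand` then inserts `side₄` after `e` and
`side₂` after `side₃`. -/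
def squareMove {E : Type*} [DecidableEq E] (Γ : BipartiteMap E) (e : E) : BipartiteMap E where
  black :=
    let turn := [e, Γ.side₂ e, Γ.side₃ e, Γ.side₄ e].formPerm
    turn * Γ.black * turn⁻¹
  white :=
    let contract := Equiv.swap e (Γ.side₂ e) * Equiv.swap (Γ.side₃ e) (Γ.side₄ e)
    let relabel := [e, Γ.side₂ e, Γ.leg₁ e].formPerm * [Γ.side₃ e, Γ.side₄ e, Γ.leg₂ e].formPerm
    let expand := Equiv.swap e (Γ.side₄ e) * Equiv.swap (Γ.side₃ e) (Γ.side₂ e)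
    relabel * (Γ.white * contract) * relabel⁻¹ * expand

/-- The effect of the square move on edge weights.  A gauge transformation at the two black corners
first gives both legs the weight `1`, and the left, top, right and bottom sides the weights
`a, b, c, d`; the new weight of every side is the old weight of the opposite side divided by
`a c + b d`, and the new legs have weight `1`. -/
noncomputable def squareMoveWeight {E : Type*} [DecidableEq E] (Γ : BipartiteMap E) (e : E)
    (wt : E → PosReal) : E → PosReal :=
  let a := wt e / wt (Γ.leg₁ e)
  let b := wt (Γ.side₄ e) / wt (Γ.leg₁ e)
  let c := wt (Γ.side₃ e) / wt (Γ.leg₂ e)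
  let d := wt (Γ.side₂ e) / wt (Γ.leg₂ e)
  fun z =>
    if z = e then c / (a * c + b * d)
    else if z = Γ.side₂ e then b / (a * c + b * d)
    else if z = Γ.side₃ e then a / (a * c + b * d)
    else if z = Γ.side₄ e then d / (a * c + b * d)
    else if z = Γ.leg₁ e ∨ z = Γ.leg₂ e then 1
    else wt z

theorem squareMove_black {E : Type*} [DecidableEq E] (Γ : BipartiteMap E) (e : E)
    (h : Γ.IsSquareFace e) :
    (Γ.squareMove e).black e = Γ.leg₁ e ∧
    (Γ.squareMove e).black (Γ.leg₁ e) = Γ.side₂ e ∧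
    (Γ.squareMove e).black (Γ.side₂ e) = e ∧
    (Γ.squareMove e).black (Γ.side₃ e) = Γ.leg₂ e ∧
    (Γ.squareMove e).black (Γ.leg₂ e) = Γ.side₄ e ∧
    (Γ.squareMove e).black (Γ.side₄ e) = Γ.side₃ e ∧
    ∀ z, z ∉ [e, Γ.side₂ e, Γ.side₃ e, Γ.side₄ e, Γ.leg₁ e, Γ.leg₂ e] →
      (Γ.squareMove e).black z = Γ.black z ∧
      Γ.black z ∉ [e, Γ.side₂ e, Γ.side₃ e, Γ.side₄ e, Γ.leg₁ e, Γ.leg₂ e] := by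
  have hb1 : Γ.black e = Γ.side₄ e := by rw [Equiv.Perm.eq_inv_iff_eq.1 h.closes.symm]
  have hb4 := h.trivalent₁
  have hx1 : Γ.black (Γ.leg₁ e) = e := by simp [leg₁]
  have hb2 := h.trivalent₂
  have hb3 : Γ.black (Γ.side₃ e) = Γ.side₂ e := by simp [side₃]
  have hx2 : Γ.black (Γ.leg₂ e) = Γ.side₃ e := by simp [leg₂]
  have hn := h.nodup
  simp only [squareMove]
  generalize Γ.side₂ e = e2 at *
  generalize Γ.side₃ e = e3 at *
  generalize Γ.side₄ e = e4 at *
  generalize Γ.leg₁ e = x1 at *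
  generalize Γ.leg₂ e = x2 at *
  have hinj := Γ.black.injective
  generalize Γ.black = b at *
  simp only [List.nodup_cons, List.mem_cons, List.not_mem_nil, not_or, or_false] at hn ⊢
  obtain ⟨⟨h1, h2, h3, h4, h5⟩, ⟨h6, h7, h8, h9⟩, ⟨h10, h11, h12⟩, ⟨h13, h14⟩, h15, -⟩ := hn
  have ht : ∀ z, z ≠ e → z ≠ e2 → z ≠ e3 → z ≠ e4 → ([e, e2, e3, e4].formPerm) z = z := by
    intro z a1 a2 a3 a4
    exact List.formPerm_apply_of_notMem (by simp [a1, a2, a3, a4])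
  have t1 : ([e, e2, e3, e4].formPerm) e = e2 := by simp [Equiv.swap_apply_def]; grind
  have t2 : ([e, e2, e3, e4].formPerm) e2 = e3 := by simp [Equiv.swap_apply_def]; grind
  have t3 : ([e, e2, e3, e4].formPerm) e3 = e4 := by simp [Equiv.swap_apply_def]; grind
  have t4 : ([e, e2, e3, e4].formPerm) e4 = e := by simp
  have tx1 := ht x1 (Ne.symm h4) (Ne.symm h8) (Ne.symm h11) (Ne.symm h13)
  have tx2 := ht x2 (Ne.symm h5) (Ne.symm h9) (Ne.symm h12) (Ne.symm h14)
  generalize ([e, e2, e3, e4].formPerm) = t at *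
  have i1 : t⁻¹ e2 = e := Equiv.Perm.inv_eq_iff_eq.2 t1.symm
  have i2 : t⁻¹ e3 = e2 := Equiv.Perm.inv_eq_iff_eq.2 t2.symm
  have i3 : t⁻¹ e4 = e3 := Equiv.Perm.inv_eq_iff_eq.2 t3.symm
  have i4 : t⁻¹ e = e4 := Equiv.Perm.inv_eq_iff_eq.2 t4.symm
  have ix1 : t⁻¹ x1 = x1 := Equiv.Perm.inv_eq_iff_eq.2 tx1.symm
  have ix2 : t⁻¹ x2 = x2 := Equiv.Perm.inv_eq_iff_eq.2 tx2.symm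
  simp only [Equiv.Perm.mul_apply]
  refine ⟨?_, ?_, ?_, ?_, ?_, ?_, ?_⟩
  · rw [i4, hb4, tx1]
  · rw [ix1, hx1, t1]
  · rw [i1, hb1, t4]
  · rw [i2, hb2, tx2]
  · rw [ix2, hx2, t3]
  · rw [i3, hb3, t2]
  · rintro z ⟨z1, z2, z3, z4, z5, z6⟩
    have iz : t⁻¹ z = z := Equiv.Perm.inv_eq_iff_eq.2 (ht z z1 z2 z3 z4).symm
    have c : b z ≠ e ∧ b z ≠ e2 ∧ b z ≠ e3 ∧ b z ≠ e4 ∧ b z ≠ x1 ∧ b z ≠ x2 := by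
      refine ⟨?_, ?_, ?_, ?_, ?_, ?_⟩ <;> intro hz
      · exact z5 (hinj (hz.trans hx1.symm))
      · exact z3 (hinj (hz.trans hb3.symm))
      · exact z6 (hinj (hz.trans hx2.symm))
      · exact z1 (hinj (hz.trans hb1.symm))
      · exact z4 (hinj (hz.trans hb4.symm))
      · exact z2 (hinj (hz.trans hb2.symm))
    refine ⟨?_, c⟩
    rw [iz, ht _ c.1 c.2.1 c.2.2.1 c.2.2.2.1]

/-- The first edge of what the square move puts in place of `z` in a white rotation (`z` itself
when `z` is not one of the four symbols that are replaced). -/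
def squareRename {E : Type*} [DecidableEq E] (Γ : BipartiteMap E) (e z : E) : E :=
  if z = Γ.side₂ e then Γ.leg₁ e else if z = Γ.leg₁ e then e
  else if z = Γ.side₄ e then Γ.leg₂ e else if z = Γ.leg₂ e then Γ.side₃ e else z

theorem squareMove_white {E : Type*} [DecidableEq E] (Γ : BipartiteMap E) (e : E)
    (h : Γ.IsSquareFace e) :
    (Γ.squareMove e).white e = Γ.side₄ e ∧
    (Γ.squareMove e).white (Γ.side₃ e) = Γ.side₂ e ∧
    (Γ.squareMove e).white (Γ.side₄ e) = Γ.squareRename e (Γ.white (Γ.leg₁ e)) ∧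
    (Γ.squareMove e).white (Γ.side₂ e) = Γ.squareRename e (Γ.white (Γ.leg₂ e)) ∧
    (Γ.squareMove e).white (Γ.leg₁ e) = Γ.squareRename e (Γ.white e) ∧
    (Γ.squareMove e).white (Γ.leg₂ e) = Γ.squareRename e (Γ.white (Γ.side₃ e)) ∧
    ∀ z, z ∉ [e, Γ.side₂ e, Γ.side₃ e, Γ.side₄ e, Γ.leg₁ e, Γ.leg₂ e] →
      (Γ.squareMove e).white z = Γ.squareRename e (Γ.white z) := by
  have hw2 : Γ.white (Γ.side₂ e) = e := by simp [side₂]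
  have hw4 : Γ.white (Γ.side₄ e) = Γ.side₃ e := by simp [side₄]
  have hn := h.nodup
  simp only [squareMove, squareRename]
  generalize Γ.side₂ e = e2 at *
  generalize Γ.side₃ e = e3 at *
  generalize Γ.side₄ e = e4 at *
  generalize Γ.leg₁ e = x1 at *
  generalize Γ.leg₂ e = x2 at *
  have hinj := Γ.white.injective
  generalize Γ.white = w at *
  simp only [List.nodup_cons, List.mem_cons, List.not_mem_nil, not_or, or_false] at hn ⊢
  obtain ⟨⟨h1, h2, h3, h4, h5⟩, ⟨h6, h7, h8, h9⟩, ⟨h10, h11, h12⟩, ⟨h13, h14⟩, h15, -⟩ := hn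
  set r := [e, e2, x1].formPerm * [e3, e4, x2].formPerm with hr
  have r1 : r e = e2 := by
    simp only [hr, List.formPerm_cons_cons, List.formPerm_singleton, mul_one,
      Equiv.Perm.mul_apply, Equiv.swap_apply_def]
    grind
  have r2 : r e2 = x1 := by simp [hr, Equiv.swap_apply_def]; grind
  have rx1 : r x1 = e := by simp [hr, Equiv.swap_apply_def]; grind
  have r3 : r e3 = e4 := by simp [hr, Equiv.swap_apply_def]; grind
  have r4 : r e4 = x2 := by simp [hr, Equiv.swap_apply_def]; grind
  have rx2 : r x2 = e3 := by simp [hr, Equiv.swap_apply_def]; grind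
  have rz : ∀ z, z ≠ e → z ≠ e2 → z ≠ e3 → z ≠ e4 → z ≠ x1 → z ≠ x2 → r z = z := by
    intro z a1 a2 a3 a4 a5 a6
    simp [hr, Equiv.swap_apply_def, a1, a2, a3, a4, a5, a6]
  have ren : ∀ z, z ≠ e → z ≠ e3 → r z = if z = e2 then x1 else if z = x1 then e
      else if z = e4 then x2 else if z = x2 then e3 else z := by
    intro z a1 a3
    grind
  clear_value r
  have i1 : r⁻¹ e2 = e := Equiv.Perm.inv_eq_iff_eq.2 r1.symm
  have i2 : r⁻¹ x1 = e2 := Equiv.Perm.inv_eq_iff_eq.2 r2.symm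
  have i3 : r⁻¹ e = x1 := Equiv.Perm.inv_eq_iff_eq.2 rx1.symm
  have i4 : r⁻¹ e4 = e3 := Equiv.Perm.inv_eq_iff_eq.2 r3.symm
  have i5 : r⁻¹ x2 = e4 := Equiv.Perm.inv_eq_iff_eq.2 r4.symm
  have i6 : r⁻¹ e3 = x2 := Equiv.Perm.inv_eq_iff_eq.2 rx2.symm
  have iz : ∀ z, z ≠ e → z ≠ e2 → z ≠ e3 → z ≠ e4 → z ≠ x1 → z ≠ x2 → r⁻¹ z = z :=
    fun z a1 a2 a3 a4 a5 a6 => Equiv.Perm.inv_eq_iff_eq.2 (rz z a1 a2 a3 a4 a5 a6).symm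
  have wne : ∀ z, z ≠ e2 → z ≠ e4 → w z ≠ e ∧ w z ≠ e3 := fun z a b =>
    ⟨fun c => a (hinj (c.trans hw2.symm)), fun c => b (hinj (c.trans hw4.symm))⟩
  have ren' : ∀ z, z ≠ e2 → z ≠ e4 → r (w z) = if w z = e2 then x1 else if w z = x1 then e
      else if w z = e4 then x2 else if w z = x2 then e3 else w z :=
    fun z a b => ren _ (wne z a b).1 (wne z a b).2
  simp only [Equiv.Perm.mul_apply]
  refine ⟨?_, ?_, ?_, ?_, ?_, ?_, ?_⟩
  · have : Equiv.swap e e4 (Equiv.swap e3 e2 e) = e4 := by simp [Equiv.swap_apply_def]; grind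
    rw [this, i4]
    have : Equiv.swap e e2 (Equiv.swap e3 e4 e3) = e4 := by simp [Equiv.swap_apply_def]; grind
    rw [this, hw4, r3]
  · have : Equiv.swap e e4 (Equiv.swap e3 e2 e3) = e2 := by simp [Equiv.swap_apply_def]; grind
    rw [this, i1]
    have : Equiv.swap e e2 (Equiv.swap e3 e4 e) = e2 := by simp [Equiv.swap_apply_def]; grind
    rw [this, hw2, r1]
  · have : Equiv.swap e e4 (Equiv.swap e3 e2 e4) = e := by simp [Equiv.swap_apply_def]; grind
    rw [this, i3]
    have : Equiv.swap e e2 (Equiv.swap e3 e4 x1) = x1 := by simp [Equiv.swap_apply_def]; grind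
    rw [this, ren' _ (Ne.symm h8) (Ne.symm h13)]
  · have : Equiv.swap e e4 (Equiv.swap e3 e2 e2) = e3 := by simp [Equiv.swap_apply_def]; grind
    rw [this, i6]
    have : Equiv.swap e e2 (Equiv.swap e3 e4 x2) = x2 := by simp [Equiv.swap_apply_def]; grind
    rw [this, ren' _ (Ne.symm h9) (Ne.symm h14)]
  · have : Equiv.swap e e4 (Equiv.swap e3 e2 x1) = x1 := by simp [Equiv.swap_apply_def]; grind
    rw [this, i2]
    have : Equiv.swap e e2 (Equiv.swap e3 e4 e2) = e := by simp [Equiv.swap_apply_def]; grind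
    rw [this, ren' _ h1 h3]
  · have : Equiv.swap e e4 (Equiv.swap e3 e2 x2) = x2 := by simp [Equiv.swap_apply_def]; grind
    rw [this, i5]
    have : Equiv.swap e e2 (Equiv.swap e3 e4 e4) = e3 := by simp [Equiv.swap_apply_def]; grind
    rw [this, ren' _ (Ne.symm h6) h10]
  · rintro z ⟨z1, z2, z3, z4, z5, z6⟩
    have : Equiv.swap e e4 (Equiv.swap e3 e2 z) = z := by simp [Equiv.swap_apply_def]; grind
    rw [this, iz z z1 z2 z3 z4 z5 z6]
    have : Equiv.swap e e2 (Equiv.swap e3 e4 z) = z := by simp [Equiv.swap_apply_def]; grind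
    rw [this, ren' _ z2 z4]

theorem squareMoveWeight_gauge {E : Type*} [DecidableEq E] (Γ : BipartiteMap E) (e : E)
    (h : Γ.IsSquareFace e) {wt wt' : E → PosReal} (hg : Γ.GaugeEquiv wt wt') :
    (Γ.squareMove e).GaugeEquiv (Γ.squareMoveWeight e wt) (Γ.squareMoveWeight e wt') := by
  obtain ⟨p, q, hp, hq, hpq⟩ := (gaugeEquiv_iff _ _ _).1 hg
  obtain ⟨b1, b2, b3, b4, b5, b6, bz⟩ := Γ.squareMove_black e h
  obtain ⟨w1, w2, w3, w4, w5, w6, wz⟩ := Γ.squareMove_white e h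
  have hw2 : Γ.white (Γ.side₂ e) = e := by simp [side₂]
  have hw4 : Γ.white (Γ.side₄ e) = Γ.side₃ e := by simp [side₄]
  have hp1 : p e = p (Γ.leg₁ e) := by rw [← hp (Γ.leg₁ e)]; simp [leg₁]
  have hp4 : p (Γ.side₄ e) = p (Γ.leg₁ e) := by rw [← hp (Γ.side₄ e), h.trivalent₁]
  have hp3 : p (Γ.side₃ e) = p (Γ.leg₂ e) := by rw [← hp (Γ.leg₂ e)]; simp [leg₂]
  have hp2 : p (Γ.side₂ e) = p (Γ.leg₂ e) := by rw [← hp (Γ.side₂ e), h.trivalent₂]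
  have hq2 : q (Γ.side₂ e) = q e := by rw [← hq (Γ.side₂ e), hw2]
  have hq4 : q (Γ.side₄ e) = q (Γ.side₃ e) := by rw [← hq (Γ.side₄ e), hw4]
  have hn := h.nodup
  refine (gaugeEquiv_iff _ _ _).2
    ⟨fun z => if z = e ∨ z = Γ.side₂ e ∨ z = Γ.leg₁ e then q e
      else if z = Γ.side₃ e ∨ z = Γ.side₄ e ∨ z = Γ.leg₂ e then q (Γ.side₃ e) else p z,
    fun z => if z = e ∨ z = Γ.side₄ e then q (Γ.leg₁ e)
      else if z = Γ.side₂ e ∨ z = Γ.side₃ e then q (Γ.leg₂ e)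
      else if z = Γ.leg₁ e then q e else if z = Γ.leg₂ e then q (Γ.side₃ e) else q z,
    ?_, ?_, ?_⟩
  · intro z
    simp only [List.nodup_cons, List.mem_cons, List.not_mem_nil, not_or, or_false] at hn bz
    grind
  · have wne : ∀ z, z ≠ Γ.side₂ e → z ≠ Γ.side₄ e →
        Γ.white z ≠ e ∧ Γ.white z ≠ Γ.side₃ e := fun z a b =>
      ⟨fun c => a (Γ.white.injective (c.trans hw2.symm)),
        fun c => b (Γ.white.injective (c.trans hw4.symm))⟩
    simp only [List.nodup_cons, List.mem_cons, List.not_mem_nil, not_or, or_false] at hn wz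
    obtain ⟨⟨h1, h2, h3, h4, h5⟩, ⟨h6, h7, h8, h9⟩, ⟨h10, h11, h12⟩, ⟨h13, h14⟩, h15, -⟩ := hn
    set Q : E → PosReal := fun z => if z = e ∨ z = Γ.side₄ e then q (Γ.leg₁ e)
      else if z = Γ.side₂ e ∨ z = Γ.side₃ e then q (Γ.leg₂ e)
      else if z = Γ.leg₁ e then q e else if z = Γ.leg₂ e then q (Γ.side₃ e) else q z with hQ
    have Q1 : Q e = q (Γ.leg₁ e) := by simp [hQ]
    have Q4 : Q (Γ.side₄ e) = q (Γ.leg₁ e) := by simp [hQ]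
    have Q2 : Q (Γ.side₂ e) = q (Γ.leg₂ e) := by simp [hQ, Ne.symm h1, h7]
    have Q3 : Q (Γ.side₃ e) = q (Γ.leg₂ e) := by simp [hQ, Ne.symm h2, h10]
    have Q5 : Q (Γ.leg₁ e) = q e := by
      simp [hQ, Ne.symm h4, Ne.symm h8, Ne.symm h11, Ne.symm h13]
    have Q6 : Q (Γ.leg₂ e) = q (Γ.side₃ e) := by
      simp [hQ, Ne.symm h5, Ne.symm h9, Ne.symm h12, Ne.symm h14, Ne.symm h15]
    have Qz : ∀ z, z ≠ e → z ≠ Γ.side₂ e → z ≠ Γ.side₃ e → z ≠ Γ.side₄ e → z ≠ Γ.leg₁ e →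
        z ≠ Γ.leg₂ e → Q z = q z := by
      intro z a1 a2 a3 a4 a5 a6
      simp [hQ, a1, a2, a3, a4, a5, a6]
    clear_value Q
    have hR : ∀ y, y ≠ Γ.side₂ e → y ≠ Γ.side₄ e → Q (Γ.squareRename e (Γ.white y)) = q y := by
      intro y y2 y4
      obtain ⟨a, b⟩ := wne y y2 y4
      rw [← hq y]
      generalize Γ.white y = y at *
      unfold squareRename
      split_ifs with c1 c2 c3 c4
      · rw [c1, Q5, hq2]
      · rw [c2, Q1]
      · rw [c3, Q6, hq4]
      · rw [c4, Q3]
      · exact Qz y a c1 b c3 c2 c4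
    intro z
    by_cases z1 : z = e
    · rw [z1, w1, Q4, Q1]
    by_cases z2 : z = Γ.side₂ e
    · rw [z2, w4, hR _ (Ne.symm h9) (Ne.symm h14), Q2]
    by_cases z3 : z = Γ.side₃ e
    · rw [z3, w2, Q2, Q3]
    by_cases z4 : z = Γ.side₄ e
    · rw [z4, w3, hR _ (Ne.symm h8) (Ne.symm h13), Q4]
    by_cases z5 : z = Γ.leg₁ e
    · rw [z5, w5, hR _ h1 h3, Q5]
    by_cases z6 : z = Γ.leg₂ e
    · rw [z6, w6, hR _ (Ne.symm h6) h10, Q6]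
    rw [wz z ⟨z1, z2, z3, z4, z5, z6⟩, hR _ z2 z4, Qz z z1 z2 z3 z4 z5 z6]
  · intro z
    simp only [squareMoveWeight, hpq]
    rw [hp1, hp2, hp3, hp4, hq2, hq4]
    simp only [List.nodup_cons, List.mem_cons, List.not_mem_nil, not_or, or_false] at hn
    have key : ∀ P Q A B C D X Y q1 q3 r1 r3 : PosReal,
      (P⁻¹ * A * q1 / (P⁻¹ * X * r1)) * (Q⁻¹ * C * q3 / (Q⁻¹ * Y * r3)) +
        (P⁻¹ * B * q3 / (P⁻¹ * X * r1)) * (Q⁻¹ * D * q1 / (Q⁻¹ * Y * r3)) =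
      (A / X * (C / Y) + B / X * (D / Y)) * (q1 * q3 / (r1 * r3)) := by
      intro P Q A B C D X Y q1 q3 r1 r3
      have := P.2.ne'; have := Q.2.ne'; have := X.2.ne'; have := Y.2.ne'
      have := r1.2.ne'; have := r3.2.ne'
      apply Subtype.ext
      simp only [div_eq_mul_inv, Positive.val_mul, Positive.coe_add, Positive.coe_inv]
      field_simp
    rw [key]
    obtain ⟨⟨h1, h2, h3, h4, h5⟩, ⟨h6, h7, h8, h9⟩, ⟨h10, h11, h12⟩, ⟨h13, h14⟩, h15, -⟩ := hn
    have side : ∀ P A X Δ q1 r1 s t : PosReal, (P⁻¹ * A * q1 / (P⁻¹ * X * r1)) /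
        (Δ * (q1 * s / (r1 * t))) = s⁻¹ * (A / X / Δ) * t := by
      intro P A X Δ q1 r1 s t
      have := P.2.ne'; have := X.2.ne'; have := q1.2.ne'; have := s.2.ne'
      have := r1.2.ne'; have := t.2.ne'; have := Δ.2.ne'
      apply Subtype.ext
      simp only [div_eq_mul_inv, Positive.val_mul, Positive.coe_inv]
      field_simp
    have side' : ∀ P A X Δ q1 r1 s t : PosReal, (P⁻¹ * A * q1 / (P⁻¹ * X * r1)) /
        (Δ * (s * q1 / (t * r1))) = s⁻¹ * (A / X / Δ) * t := by
      intro P A X Δ q1 r1 s t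
      rw [mul_comm s, mul_comm t, side]
    have side₁ : ∀ P A X Δ q1 r1 s t : PosReal, (P⁻¹ * A * q1 / (P⁻¹ * X * r1)) /
        (Δ * (s * q1 / (r1 * t))) = s⁻¹ * (A / X / Δ) * t := by
      intro P A X Δ q1 r1 s t
      rw [mul_comm s, side]
    have side₂ : ∀ P A X Δ q1 r1 s t : PosReal, (P⁻¹ * A * q1 / (P⁻¹ * X * r1)) /
        (Δ * (q1 * s / (t * r1))) = s⁻¹ * (A / X / Δ) * t := by
      intro P A X Δ q1 r1 s t
      rw [mul_comm t, side]
    generalize wt e / wt (Γ.leg₁ e) * (wt (Γ.side₃ e) / wt (Γ.leg₂ e)) +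
      wt (Γ.side₄ e) / wt (Γ.leg₁ e) * (wt (Γ.side₂ e) / wt (Γ.leg₂ e)) = Δ
    by_cases z1 : z = e
    · simp [z1, side']
    by_cases z2 : z = Γ.side₂ e
    · simp [z2, Ne.symm h1, h6, h7, side₁]
    by_cases z3 : z = Γ.side₃ e
    · simp [z3, Ne.symm h2, Ne.symm h6, h10, h11, side]
    by_cases z4 : z = Γ.side₄ e
    · simp [z4, Ne.symm h3, Ne.symm h7, Ne.symm h10, h13, side₂]
    by_cases z5 : z = Γ.leg₁ e
    · simp [z5, Ne.symm h4, Ne.symm h8, Ne.symm h11, Ne.symm h13]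
    by_cases z6 : z = Γ.leg₂ e
    · simp [z6, Ne.symm h5, Ne.symm h9, Ne.symm h12, Ne.symm h14, Ne.symm h15]
    simp [z1, z2, z3, z4, z5, z6]

/-- Perform the square moves at the faces on the left of the listed edges, one after the other. -/
def squareMoves {E : Type*} [DecidableEq E] (Γ : BipartiteMap E) : List E → BipartiteMap E
  | [] => Γ
  | e :: l => (Γ.squareMove e).squareMoves l

/-- The effect on edge weights of a sequence of square moves. -/
noncomputable def squareMovesWeight {E : Type*} [DecidableEq E] (Γ : BipartiteMap E) :
    List E → (E → PosReal) → (E → PosReal)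
  | [], wt => wt
  | e :: l, wt => (Γ.squareMove e).squareMovesWeight l (Γ.squareMoveWeight e wt)

/-- Every move of the sequence is performed at a square face of the graph obtained so far. -/
def IsSquareSequence {E : Type*} [DecidableEq E] (Γ : BipartiteMap E) : List E → Prop
  | [] => True
  | e :: l => Γ.IsSquareFace e ∧ (Γ.squareMove e).IsSquareSequence l

theorem squareMovesWeight_gauge {E : Type*} [DecidableEq E] (l : List E) :
    ∀ (Γ : BipartiteMap E), Γ.IsSquareSequence l → ∀ {wt wt' : E → PosReal},
      Γ.GaugeEquiv wt wt' →
      (Γ.squareMoves l).GaugeEquiv (Γ.squareMovesWeight l wt) (Γ.squareMovesWeight l wt') := by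
  induction l with
  | nil => intro Γ _ wt wt' h; exact h
  | cons e l ih =>
    intro Γ hl wt wt' h
    exact ih _ hl.2 (Γ.squareMoveWeight_gauge e hl.1 h)

/-- The map of weight classes induced by a sequence of square moves. -/
noncomputable def squareMovesX {E : Type*} [DecidableEq E] (Γ : BipartiteMap E) (l : List E)
    (hl : Γ.IsSquareSequence l) : Γ.X → (Γ.squareMoves l).X :=
  Quotient.map' (s₁ := Γ.gaugeSetoid) (s₂ := (Γ.squareMoves l).gaugeSetoid)
    (Γ.squareMovesWeight l) (fun _ _ h => squareMovesWeight_gauge l Γ hl h)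

end BipartiteMap

/-- The edges of `G^□`.  An edge `ε` of `G` is replaced by a square face with sides parallel to `ε`
or crossing `ε`.  For a dart `d` with underlying edge `ε`, `cross d` is the side that crosses `ε`
next to the base vertex of `d`, `along d` is the side parallel to `ε` on the left of `d`, and
`corner d` is the edge joining the square of `d` to the square of the next dart counterclockwise
around the base vertex of `d`. -/
inductive BoxEdge (D : Type*) where
  | cross (d : D) : BoxEdge D
  | along (d : D) : BoxEdge D
  | corner (d : D) : BoxEdge D
  deriving DecidableEq

namespace TorusGraph

open BoxEdge

/-- The bipartite graph `G^□`.  Near the base vertex of a dart `d` the square of `d` has a black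
vertex on the left of `d`, with edges `cross d`, `along d`, `corner d` in counterclockwise order,
and a white vertex on the right of `d`, with edges `along (rev d)`, `cross d`, `corner (next⁻¹ d)`
in counterclockwise order. -/
def box {D : Type*} (G : TorusGraph D) : BipartiteMap (BoxEdge D) where
  black :=
    { toFun := fun
        | cross d => along d
        | along d => corner d
        | corner d => cross d
      invFun := fun
        | cross d => corner d
        | along d => cross d
        | corner d => along d
      left_inv := by rintro (d | d | d) <;> rfl
      right_inv := by rintro (d | d | d) <;> rfl }
  white :=
    { toFun := fun
        | along d => cross (G.rev d)
        | cross d => corner (G.next⁻¹ d)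
        | corner d => along (G.rev (G.next d))
      invFun := fun
        | cross d => along (G.rev d)
        | corner d => cross (G.next d)
        | along d => corner (G.next⁻¹ (G.rev d))
      left_inv := by rintro (d | d | d) <;> simp [G.rev_rev]
      right_inv := by rintro (d | d | d) <;> simp [G.rev_rev] }

/-- The edge weight of `G^□` given by coupling constants `J : E(G) → ℝ_{>0}`: the sides of the
square of `ε` crossing `ε` have weight `s_ε = sech (2 J_ε)`, the sides parallel to `ε` have weight
`c_ε = tanh (2 J_ε)`, and the edges joining different squares have weight `1`. -/
noncomputable def isingWeight {D : Type*} (G : TorusGraph D) (J : G.Edge → PosReal) :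
    BoxEdge D → PosReal
  | cross d => ⟨1 / Real.cosh (2 * (J (G.edge d) : ℝ)), by positivity⟩
  | along d => ⟨Real.tanh (2 * (J (G.edge d) : ℝ)), by
      rw [Real.tanh_eq_sinh_div_cosh]
      have := Real.sinh_pos_iff.2 (mul_pos two_pos (J (G.edge d)).2)
      positivity⟩
  | corner _ => 1

/-- The map `I_G(ℝ_{>0}) → X_{G^□}(ℝ_{>0})` sending an Ising model to the class of its weight. -/
noncomputable def isingClass {D : Type*} (G : TorusGraph D) (J : G.Edge → PosReal) : G.box.X :=
  G.box.weightClass (G.isingWeight J)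

/-- `l` lists every edge of `G` exactly once, each with some orientation. -/
def IsEdgeList {D : Type*} (G : TorusGraph D) (l : List D) : Prop :=
  (l.map G.edge).Nodup ∧ ∀ ε : G.Edge, ε ∈ l.map G.edge

theorem edge_eq_iff {D : Type*} (G : TorusGraph D) (d d' : D) :
    G.edge d = G.edge d' ↔ d = d' ∨ d = G.rev d' := by
  have h2 : G.rev ^ (2 : ℤ) = 1 := by
    rw [zpow_two]; exact Equiv.ext fun x => G.rev_rev x
  constructor
  · intro h
    obtain ⟨n, hn⟩ : G.rev.SameCycle d d' := Quotient.exact h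
    rcases Int.even_or_odd' n with ⟨k, rfl | rfl⟩
    · left
      rwa [zpow_mul, h2, one_zpow, Equiv.Perm.one_apply] at hn
    · right
      rw [← hn]
      rw [zpow_add, zpow_mul, h2, one_zpow, zpow_one, one_mul, G.rev_rev]
  · rintro (rfl | rfl)
    · rfl
    · exact Quotient.sound (Equiv.Perm.sameCycle_apply_left.2 (Equiv.Perm.SameCycle.refl _ _))

/-- The rotations after the square moves at the squares of the darts satisfying `T`. -/
def IsStage {D : Type*} (G : TorusGraph D) (T : D → Prop) (Γ : BipartiteMap (BoxEdge D)) :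
    Prop :=
  (∀ d, T d → Γ.black (cross d) = corner d ∧ Γ.black (corner d) = along (G.rev d) ∧
    Γ.black (along d) = cross (G.rev d)) ∧
  (∀ d, ¬ T d → Γ.black (cross d) = along d ∧ Γ.black (along d) = corner d ∧
    Γ.black (corner d) = cross d) ∧
  (∀ d, T d → Γ.white (cross d) = along d) ∧
  (∀ d, ¬ T d → Γ.white (along d) = cross (G.rev d)) ∧
  (∀ d, T (G.next d) → (T d → Γ.white (along d) = corner (G.next d)) ∧
    (¬ T d → Γ.white (corner d) = corner (G.next d))) ∧
  (∀ d, ¬ T (G.next d) → (T d → Γ.white (along d) = along (G.rev (G.next d))) ∧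
    (¬ T d → Γ.white (corner d) = along (G.rev (G.next d)))) ∧
  (∀ d, T d → (T (G.next d) → Γ.white (corner (G.next d)) = cross d) ∧
    (¬ T (G.next d) → Γ.white (cross (G.next d)) = cross d)) ∧
  (∀ d, ¬ T d → (T (G.next d) → Γ.white (corner (G.next d)) = corner d) ∧
    (¬ T (G.next d) → Γ.white (cross (G.next d)) = corner d))

theorem box_isStage {D : Type*} (G : TorusGraph D) : G.IsStage (fun _ => False) G.box := by
  refine ⟨?_, ?_, ?_, ?_, ?_, ?_, ?_, ?_⟩ <;> simp [box]

theorem IsStage.sides {D : Type*} {G : TorusGraph D} {T : D → Prop}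
    {Γ : BipartiteMap (BoxEdge D)} (h : G.IsStage T Γ) (hT : ∀ d, T (G.rev d) ↔ T d)
    {d : D} (hd : ¬ T d) :
    Γ.side₂ (cross d) = along (G.rev d) ∧ Γ.side₃ (cross d) = cross (G.rev d) ∧
    Γ.side₄ (cross d) = along d ∧ Γ.leg₁ (cross d) = corner d ∧
    Γ.leg₂ (cross d) = corner (G.rev d) := by
  obtain ⟨-, hb, -, hw, -⟩ := h
  have hd' : ¬ T (G.rev d) := by rwa [hT]
  have e2 : Γ.side₂ (cross d) = along (G.rev d) := by
    rw [BipartiteMap.side₂, Equiv.Perm.inv_eq_iff_eq, hw _ hd', G.rev_rev]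
  have e3 : Γ.side₃ (cross d) = cross (G.rev d) := by
    rw [BipartiteMap.side₃, e2, Equiv.Perm.inv_eq_iff_eq, (hb _ hd').1]
  have e4 : Γ.side₄ (cross d) = along d := by
    rw [BipartiteMap.side₄, e3, Equiv.Perm.inv_eq_iff_eq, hw _ hd]
  refine ⟨e2, e3, e4, ?_, ?_⟩
  · rw [BipartiteMap.leg₁, Equiv.Perm.inv_eq_iff_eq, (hb _ hd).2.2]
  · rw [BipartiteMap.leg₂, e3, Equiv.Perm.inv_eq_iff_eq, (hb _ hd').2.2]

theorem IsStage.isSquareFace {D : Type*} {G : TorusGraph D} {T : D → Prop}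
    {Γ : BipartiteMap (BoxEdge D)} (h : G.IsStage T Γ) (hT : ∀ d, T (G.rev d) ↔ T d)
    {d : D} (hd : ¬ T d) : Γ.IsSquareFace (cross d) := by
  obtain ⟨e2, e3, e4, x1, x2⟩ := h.sides hT hd
  obtain ⟨-, hb, -, hw, -⟩ := h
  have hd' : ¬ T (G.rev d) := by rwa [hT]
  refine ⟨?_, ?_, ?_, ?_⟩
  · rw [e4, Equiv.Perm.inv_eq_iff_eq, (hb _ hd).1]
  · rw [e4, x1, (hb _ hd).2.1]
  · rw [e2, x2, (hb _ hd').2.1]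
  · rw [e2, e3, e4, x1, x2]
    have := G.rev_ne d
    simp [this, Ne.symm this]

theorem IsStage.squareMove {D : Type*} [DecidableEq D] {G : TorusGraph D} {T : D → Prop}
    {Γ : BipartiteMap (BoxEdge D)} (h : G.IsStage T Γ) (hT : ∀ d, T (G.rev d) ↔ T d)
    {d : D} (hd : ¬ T d) :
    G.IsStage (fun x => T x ∨ x = d ∨ x = G.rev d) (Γ.squareMove (cross d)) := by
  have hsq := h.isSquareFace hT hd
  obtain ⟨b1, b2, b3, b4, b5, b6, bz⟩ := Γ.squareMove_black _ hsq
  obtain ⟨w1, w2, w3, w4, w5, w6, wz⟩ := Γ.squareMove_white _ hsq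
  obtain ⟨e2, e3, e4, x1, x2⟩ := h.sides hT hd
  have hd' : ¬ T (G.rev d) := by rwa [hT]
  have hne := G.rev_ne d
  have hrr := G.rev_rev
  have hinj : ∀ x, G.rev x = d → x = G.rev d := fun x hx => by rw [← hx, G.rev_rev]
  have hinj' : ∀ x, G.rev x = G.rev d → x = d := fun x hx => G.rev.injective hx
  rw [e2, e3, e4, x1, x2] at bz wz
  rw [e2] at b2 b3 w2 w4
  rw [e3] at b4 b6 w2 w6
  rw [e4] at b5 b6 w1 w3
  rw [x1] at b1 b2 w3 w5
  rw [x2] at b4 b5 w4 w6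
  have hR : ∀ z, Γ.squareRename (cross d) z = if z = along (G.rev d) then corner d
      else if z = corner d then cross d else if z = along d then corner (G.rev d)
      else if z = corner (G.rev d) then cross (G.rev d) else z := by
    intro z
    rw [BipartiteMap.squareRename, e2, e3, e4, x1, x2]
  obtain ⟨s1, s2, s3, s4, s5, s6, s7, s8⟩ := h
  simp only [List.mem_cons, List.not_mem_nil, or_false, not_or] at bz wz
  generalize Γ.squareMove (cross d) = Γ' at *
  clear hsq e2 e3 e4 x1 x2
  obtain ⟨S, hS⟩ : ∃ S : D → Prop, ∀ y, S y ↔ (y = d ∨ y = G.rev d) := ⟨_, fun _ => Iff.rfl⟩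
  have SR : ∀ y, S (G.rev y) ↔ S y := by
    intro y
    rw [hS, hS]
    constructor
    · rintro (h | h)
      · exact Or.inr (hinj _ h)
      · exact Or.inl (hinj' _ h)
    · rintro (h | h)
      · exact Or.inr (by rw [h])
      · exact Or.inl (by rw [h, hrr])
  have ST : ∀ y, S y → ¬ T y := by
    intro y hy
    rcases (hS y).1 hy with h | h <;> rw [h]
    · exact hd
    · exact hd'
  generalize Γ.squareRename (cross d) = R at *
  have Ra : ∀ y, S y → R (along y) = corner (G.rev y) := by
    intro y hy
    rcases (hS y).1 hy with h | h <;> rw [h, hR]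
    · simp [Ne.symm hne]
    · simp [hrr]
  have Ra' : ∀ y, ¬ S y → R (along y) = along y := by
    intro y hy
    rw [hS, not_or] at hy
    simp [hR, hy]
  have Rc : ∀ y, S y → R (corner y) = cross y := by
    intro y hy
    rcases (hS y).1 hy with h | h <;> rw [h, hR]
    · simp
    · simp [hne]
  have Rc' : ∀ y, ¬ S y → R (corner y) = corner y := by
    intro y hy
    rw [hS, not_or] at hy
    simp [hR, hy]
  have Rx : ∀ y, R (cross y) = cross y := by
    intro y
    simp [hR]
  have A1 : ∀ y, S y → Γ'.white (cross y) = along y := by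
    intro y hy
    rcases (hS y).1 hy with h | h <;> rw [h]
    · exact w1
    · exact w2
  have A2 : ∀ y, S y → Γ'.white (along y) = R (Γ.white (corner y)) := by
    intro y hy
    rcases (hS y).1 hy with h | h <;> rw [h]
    · exact w3
    · exact w4
  have A3 : ∀ y, S y → Γ'.white (corner y) = R (Γ.white (cross y)) := by
    intro y hy
    rcases (hS y).1 hy with h | h <;> rw [h]
    · exact w5
    · exact w6
  have A4 : ∀ y, ¬ S y → Γ'.white (cross y) = R (Γ.white (cross y)) ∧
      Γ'.white (along y) = R (Γ.white (along y)) ∧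
      Γ'.white (corner y) = R (Γ.white (corner y)) := by
    intro y hy
    rw [hS, not_or] at hy
    exact ⟨wz _ (by simp [hy]), wz _ (by simp [hy]), wz _ (by simp [hy])⟩
  refine ⟨?_, ?_, ?_, ?_, ?_, ?_, ?_, ?_⟩
  · clear wz w1 w2 w3 w4 w5 w6 s2 s3 s4 s5 s6 s7 s8
    rintro y (hy | hy | hy)
    · obtain ⟨a1, a2, a3⟩ := s1 y hy
      have n1 : y ≠ d := by rintro rfl; exact hd hy
      have n2 : y ≠ G.rev d := by rintro rfl; exact hd' hy
      refine ⟨?_, ?_, ?_⟩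
      · rw [(bz _ (by simp [n1, n2])).1, a1]
      · rw [(bz _ (by simp [n1, n2])).1, a2]
      · rw [(bz _ (by simp [n1, n2])).1, a3]
    · rw [hy]; exact ⟨b1, b2, b6⟩
    · rw [hy, hrr]; exact ⟨b4, b5, b3⟩
  · clear wz w1 w2 w3 w4 w5 w6 s1 s3 s4 s5 s6 s7 s8
    intro y hy
    simp only [not_or] at hy
    obtain ⟨a1, a2, a3⟩ := s2 y hy.1
    refine ⟨?_, ?_, ?_⟩
    · rw [(bz _ (by simp [hy])).1, a1]
    · rw [(bz _ (by simp [hy])).1, a2]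
    · rw [(bz _ (by simp [hy])).1, a3]
  all_goals
    simp only [← hS]
    generalize Γ'.white = W' at *
    generalize Γ.white = W at *
    clear bz b1 b2 b3 b4 b5 b6 s1 s2 wz w1 w2 w3 w4 w5 w6 hR hd hd' hne hinj hinj' hT hS
    intro y
  · grind
  · grind
  · by_cases hn : S (G.next y) <;> by_cases hy : S y <;> grind
  · by_cases hn : S (G.next y) <;> by_cases hy : S y <;> grind
  · by_cases hn : S (G.next y) <;> by_cases hy : S y <;> grind
  · by_cases hn : S (G.next y) <;> by_cases hy : S y <;> grind

theorem IsStage.squareMoves {D : Type*} [DecidableEq D] {G : TorusGraph D} (l : List D) :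
    ∀ {T : D → Prop} {Γ : BipartiteMap (BoxEdge D)}, G.IsStage T Γ → (∀ d, T (G.rev d) ↔ T d) →
      (l.map G.edge).Nodup → (∀ d ∈ l, ¬ T d) →
      Γ.IsSquareSequence (l.map cross) ∧
      G.IsStage (fun x => T x ∨ G.edge x ∈ l.map G.edge) (Γ.squareMoves (l.map cross)) := by
  induction l with
  | nil =>
    intro T Γ h hT _ _
    refine ⟨trivial, ?_⟩
    simpa [BipartiteMap.squareMoves] using h
  | cons d l ih =>
    intro T Γ h hT hnd hl
    rw [List.map_cons, List.nodup_cons] at hnd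
    have hd := hl d List.mem_cons_self
    have hedge : ∀ x, (x = d ∨ x = G.rev d) ↔ G.edge x = G.edge d := fun x =>
      (G.edge_eq_iff x d).symm
    have hrev : ∀ x, G.edge (G.rev x) = G.edge x := fun x =>
      (G.edge_eq_iff _ _).2 (Or.inr rfl)
    obtain ⟨i1, i2⟩ := ih (h.squareMove hT hd)
      (by intro x; rw [hedge, hedge, hT, hrev]) hnd.2 (by
        intro x hx
        rw [hedge, not_or]
        refine ⟨hl x (List.mem_cons_of_mem _ hx), fun hx' => hnd.1 ?_⟩
        rw [← hx']
        exact List.mem_map_of_mem hx)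
    refine ⟨⟨h.isSquareFace hT hd, i1⟩, ?_⟩
    have hT' : (fun x => T x ∨ G.edge x ∈ (d :: l).map G.edge) =
        fun x => (T x ∨ x = d ∨ x = G.rev d) ∨ G.edge x ∈ l.map G.edge := by
      funext x
      rw [hedge, List.map_cons, List.mem_cons, or_assoc]
    rw [hT']
    exact i2

/-- The square moves at the squares of the edges of `G` are all performed at square faces. -/
theorem box_isSquareSequence {D : Type*} [DecidableEq D] (G : TorusGraph D) {l : List D}
    (hl : G.IsEdgeList l) : G.box.IsSquareSequence (l.map cross) :=
  (G.box_isStage.squareMoves l (fun _ => Iff.rfl) hl.1 (fun _ _ h => h)).1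

/-- The relabelling of the edges of `G^□` fixing the sides of the squares and sending `corner d`
to `corner (next⁻¹ d)`. -/
def cornerShift {D : Type*} (G : TorusGraph D) : BoxEdge D ≃ BoxEdge D where
  toFun := fun
    | cross d => cross d
    | along d => along d
    | corner d => corner (G.next⁻¹ d)
  invFun := fun
    | cross d => cross d
    | along d => along d
    | corner d => corner (G.next d)
  left_inv := by rintro (d | d | d) <;> simp
  right_inv := by rintro (d | d | d) <;> simp

/-- After square moves at the squares of all the edges of `G`, the graph is `G^□` with all colours
changed: each square keeps its place, and the leg `corner d` of the square of `d`, which now starts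
at the corner of that square to the right of `d`, is the edge `corner (next⁻¹ d)` of `G^□`. -/
def boxMovesIso {D : Type*} [DecidableEq D] (G : TorusGraph D) {l : List D}
    (hl : G.IsEdgeList l) : (G.box.squareMoves (l.map cross)).Iso G.box.colorSwap where
  toEquiv := G.cornerShift
  black := by
    obtain ⟨h, -⟩ := (G.box_isStage.squareMoves l (fun _ => Iff.rfl) hl.1 (fun _ _ h => h)).2
    have h := fun d => h d (Or.inr (hl.2 _))
    rintro (d | d | d)
    · rw [(h d).1]; rfl
    · rw [(h d).2.2]; rfl
    · rw [(h d).2.1]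
      change along (G.rev (G.next (G.next⁻¹ d))) = along (G.rev d)
      simp
  white := by
    obtain ⟨-, -, h3, -, h5, -, h7, -⟩ :=
      (G.box_isStage.squareMoves l (fun _ => Iff.rfl) hl.1 (fun _ _ h => h)).2
    have h3 := fun d => h3 d (Or.inr (hl.2 _))
    have h5 := fun d => (h5 d (Or.inr (hl.2 _))).1 (Or.inr (hl.2 _))
    have h7 := fun d => (h7 d (Or.inr (hl.2 _))).1 (Or.inr (hl.2 _))
    rintro (d | d | d)
    · rw [h3]; rfl
    · rw [h5]
      change corner d = corner (G.next⁻¹ (G.next d))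
      simp
    · obtain ⟨d, rfl⟩ := G.next.surjective d
      rw [h7]
      change cross (G.next⁻¹ (G.next d)) = cross d
      simp

/-- The map `μ` from weight classes on `G^□` to weight classes on the colour-changed graph, given
by the square moves at the squares of all the edges of `G`, in the order of the list `l`. -/
noncomputable def mu {D : Type*} [DecidableEq D] (G : TorusGraph D) (l : List D)
    (hl : G.IsEdgeList l) : G.box.X → G.box.colorSwap.X :=
  fun x => (G.boxMovesIso hl).mapX
    (G.box.squareMovesX (l.map cross) (G.box_isSquareSequence hl) x)

end TorusGraph

/-! Every gauge class contains weights equal to `1` on all edges joining squares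
(`exists_sideWeight`). Such a weight is a pair of positive functions `x`, `y` on darts, for the
sides crossing and parallel to an edge. Each joining edge forces equal gauge values at its two ends,
so the remaining gauge freedom is one positive number per dart (`sideWeight_gaugeEquiv_iff`).

A square move reads and changes only the weights over its own edge, so all the moves together have a
closed form: each side receives the weight of the opposite side divided by `S = x x⁻ + y y⁻`, where
`⁻` means evaluation at the reversed dart (`IsStage.squareMovesWeight`). The condition `μ[wt] =
[wt‾]` thus says that some gauge `g` takes `(x, y)` to `(x⁻/S, y⁻/S)` (`mu_eq_colorSwapX_iff`).

For an Ising weight, opposite sides agree and `S = sech² + tanh² = 1`, so `g = 1` works. Conversely,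
go half of the way with the gauge `√g`: the new weights are geometric means, with `x'² = x x⁻/S` and
`y'² = y y⁻/S`. They are symmetric under reversal and satisfy `x'² + y'² = 1`
(`exists_gauge_symmetric`), so `y' = tanh(2J)` and `x' = sech(2J)` for some `J`
(`exists_isingWeight_eq`).

Injectivity holds because a gauge between two symmetric weights with `x² + y² = 1` cannot change the
sides of any square (`eq_of_symmetric_rescaling`). -/

/-! ### Two facts about positive real numbers -/

/-- The squares of both sides equal `y y' / s`. This gives the symmetry of the parallel sides after
the gauge has been halved. -/
theorem mul_div_eq_of_div_eq_mul_sq_div {y y' s k k' n n' : ℝ} (hy : 0 < y) (hy' : 0 < y')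
    (hk : 0 < k) (hk' : 0 < k') (hn : 0 < n) (hn' : 0 < n')
    (h : y' / s = y * k' ^ 2 / n ^ 2) (h' : y / s = y' * k ^ 2 / n' ^ 2) :
    y' * k / n' = y * k' / n := by
  refine (sq_eq_sq₀ (by positivity) (by positivity)).1 ?_
  calc (y' * k / n') ^ 2 = y' * (y' * k ^ 2 / n' ^ 2) := by ring
    _ = y * (y' / s) := by rw [← h']; ring
    _ = (y * k' / n) ^ 2 := by rw [h]; ring

/-- Here `u`, `v` are the gauge values at the white corners of a square and `m`, `n` those at the
black corners. Cross-multiplication gives `u n = v m` and `v n = u m`. Adding these yields `m = n`,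
hence `u = v`. Then `(x, y)` is rescaled by a single positive factor, which is `1` because both
points lie on the unit circle. -/
theorem eq_of_symmetric_rescaling {x y x' y' u v m n : ℝ} (hx : 0 < x) (hy : 0 < y)
    (hu : 0 < u) (hv : 0 < v) (hm : 0 < m) (hn : 0 < n)
    (h₁ : x' = x * u / m) (h₂ : x' = x * v / n) (h₃ : y' = y * v / m) (h₄ : y' = y * u / n)
    (h : x ^ 2 + y ^ 2 = 1) (h' : x' ^ 2 + y' ^ 2 = 1) : y' = y := by
  have e₁ : u * n = v * m := by
    have : x * u / m = x * v / n := h₁.symm.trans h₂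
    rw [div_eq_div_iff hm.ne' hn.ne', mul_assoc, mul_assoc] at this
    exact mul_left_cancel₀ hx.ne' this
  have e₂ : v * n = u * m := by
    have : y * v / m = y * u / n := h₃.symm.trans h₄
    rw [div_eq_div_iff hm.ne' hn.ne', mul_assoc, mul_assoc] at this
    exact mul_left_cancel₀ hy.ne' this
  have e₃ : n = m := by
    refine mul_left_cancel₀ (add_pos hu hv).ne' ?_
    linarith
  subst e₃
  obtain rfl := mul_right_cancel₀ hn.ne' e₁
  have e₄ : (u / n) ^ 2 = 1 := by
    rw [← h', h₁, h₃]
    linear_combination -(u / n) ^ 2 * h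
  have e₅ : u / n = 1 := (pow_eq_one_iff_of_nonneg (div_pos hu hn).le two_ne_zero).1 e₄
  rw [h₃, mul_div_assoc, e₅, mul_one]

/-! ### Gauge equivalence and change of colours -/

/-- Exchanging the colours exchanges the two vertex functions, and inverting both of them
compensates for this. -/
theorem BipartiteMap.colorSwap_gaugeEquiv_iff {E : Type*} (Γ : BipartiteMap E)
    (wt wt' : E → PosReal) : Γ.colorSwap.GaugeEquiv wt wt' ↔ Γ.GaugeEquiv wt wt' := by
  rw [BipartiteMap.gaugeEquiv_iff, BipartiteMap.gaugeEquiv_iff]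
  constructor
  · rintro ⟨p, q, hp, hq, h⟩
    refine ⟨q⁻¹, p⁻¹, fun e => congrArg (·⁻¹) (hq e), fun e => congrArg (·⁻¹) (hp e), fun e => ?_⟩
    rw [h e, Pi.inv_apply, Pi.inv_apply, inv_inv, mul_comm (q e), mul_comm _ (wt e), mul_right_comm]
  · rintro ⟨p, q, hp, hq, h⟩
    refine ⟨q⁻¹, p⁻¹, fun e => congrArg (·⁻¹) (hq e), fun e => congrArg (·⁻¹) (hp e), fun e => ?_⟩
    rw [h e, Pi.inv_apply, Pi.inv_apply, inv_inv, mul_comm (q e), mul_comm _ (wt e), mul_right_comm]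

theorem BipartiteMap.weightClass_eq_iff {E : Type*} (Γ : BipartiteMap E) (wt wt' : E → PosReal) :
    Γ.weightClass wt = Γ.weightClass wt' ↔ Γ.GaugeEquiv wt wt' :=
  ⟨fun h => Quotient.exact (s := Γ.gaugeSetoid) h, fun h => Quotient.sound (s := Γ.gaugeSetoid) h⟩

/-! ### Closed form of all the square moves -/

namespace TorusGraph

open BoxEdge

/-- The dart of `G` whose square carries the black endpoint of an edge of `G^□`. -/
def _root_.BoxEdge.dart {D : Type*} : BoxEdge D → D
  | cross d => d
  | along d => d
  | corner d => d

/-- The quantity `a c + b d` of the square of `d`. -/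
noncomputable def squareSum {D : Type*} (G : TorusGraph D) (wt : BoxEdge D → PosReal) (d : D) :
    PosReal :=
  wt (cross d) / wt (corner d) * (wt (cross (G.rev d)) / wt (corner (G.rev d))) +
    wt (along d) / wt (corner d) * (wt (along (G.rev d)) / wt (corner (G.rev d)))

theorem squareSum_rev {D : Type*} (G : TorusGraph D) (wt : BoxEdge D → PosReal) (d : D) :
    G.squareSum wt (G.rev d) = G.squareSum wt d := by
  simp only [squareSum, G.rev_rev]
  rw [mul_comm (wt (cross d) / _), mul_comm (wt (along d) / _)]

/-- The weight after the square moves at all the squares. -/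
noncomputable def movedWeight {D : Type*} (G : TorusGraph D) (wt : BoxEdge D → PosReal) :
    BoxEdge D → PosReal
  | cross d => wt (cross (G.rev d)) / wt (corner (G.rev d)) / G.squareSum wt d
  | along d => wt (along (G.rev d)) / wt (corner (G.rev d)) / G.squareSum wt d
  | corner _ => 1

theorem edge_rev {D : Type*} (G : TorusGraph D) (d : D) : G.edge (G.rev d) = G.edge d :=
  (G.edge_eq_iff _ _).2 (Or.inr rfl)

/-- Until the square of `d` is moved, its sides and legs keep their names, whatever was done at
other squares. These six edges are exactly the ones whose dart is `d` or `rev d`, so the move acts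
only over the edge of `d`. -/
theorem IsStage.squareMoveWeight {D : Type*} [DecidableEq D] {G : TorusGraph D} {T : D → Prop}
    {Γ : BipartiteMap (BoxEdge D)} (h : G.IsStage T Γ) (hT : ∀ d, T (G.rev d) ↔ T d)
    {d : D} (hd : ¬ T d) (wt : BoxEdge D → PosReal) (z : BoxEdge D) :
    (G.edge z.dart = G.edge d → Γ.squareMoveWeight (cross d) wt z = G.movedWeight wt z) ∧
    (G.edge z.dart ≠ G.edge d → Γ.squareMoveWeight (cross d) wt z = wt z) := by
  obtain ⟨e2, e3, e4, x1, x2⟩ := h.sides hT hd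
  have hne := G.rev_ne d
  have hsum : wt (cross d) / wt (corner d) * (wt (cross (G.rev d)) / wt (corner (G.rev d))) +
    wt (along d) / wt (corner d) * (wt (along (G.rev d)) / wt (corner (G.rev d))) =
      G.squareSum wt d := rfl
  simp only [BipartiteMap.squareMoveWeight, e2, e3, e4, x1, x2, hsum]
  constructor
  · intro hz
    rcases z with x | x | x <;> rcases (G.edge_eq_iff x d).1 hz with rfl | rfl <;>
      simp [movedWeight, squareSum_rev, G.rev_rev, hne, hne.symm]
  · intro hz
    rcases z with x | x | x <;> obtain ⟨h1, h2⟩ := not_or.1 (mt (G.edge_eq_iff x d).2 hz) <;>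
      simp [h1, h2]

/-- Locality: the closed form involves only the six weights over one edge of `G`. This is why moves
at different squares do not interact. -/
theorem movedWeight_congr {D : Type*} (G : TorusGraph D) {wt wt' : BoxEdge D → PosReal}
    (z : BoxEdge D) (h : ∀ y : BoxEdge D, G.edge y.dart = G.edge z.dart → wt y = wt' y) :
    G.movedWeight wt z = G.movedWeight wt' z := by
  rcases z with d | d | d
  all_goals
    simp only [movedWeight, squareSum]
    try
      rw [h (cross d) rfl, h (along d) rfl, h (corner d) rfl, h (cross (G.rev d)) (G.edge_rev d),
        h (along (G.rev d)) (G.edge_rev d), h (corner (G.rev d)) (G.edge_rev d)]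

/-- By locality, the weights over an edge change only when its own square is moved, which happens
once. The result therefore does not depend on the order of the list. -/
theorem IsStage.squareMovesWeight {D : Type*} [DecidableEq D] {G : TorusGraph D} (l : List D) :
    ∀ {T : D → Prop} {Γ : BipartiteMap (BoxEdge D)}, G.IsStage T Γ → (∀ d, T (G.rev d) ↔ T d) →
      (l.map G.edge).Nodup → (∀ d ∈ l, ¬ T d) → ∀ (wt : BoxEdge D → PosReal) (z : BoxEdge D),
      (G.edge z.dart ∈ l.map G.edge →
        Γ.squareMovesWeight (l.map cross) wt z = G.movedWeight wt z) ∧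
      (G.edge z.dart ∉ l.map G.edge → Γ.squareMovesWeight (l.map cross) wt z = wt z) := by
  induction l with
  | nil => intro T Γ _ _ _ _ wt z; simp [BipartiteMap.squareMovesWeight]
  | cons d l ih =>
    intro T Γ h hT hnd hl wt z
    rw [List.map_cons, List.nodup_cons] at hnd
    have hd := hl d List.mem_cons_self
    have hedge : ∀ x, (x = d ∨ x = G.rev d) ↔ G.edge x = G.edge d := fun x =>
      (G.edge_eq_iff x d).symm
    obtain ⟨i1, i2⟩ := ih (h.squareMove hT hd)
      (by intro x; rw [hedge, hedge, hT, edge_rev]) hnd.2 (by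
        intro x hx
        rw [hedge, not_or]
        refine ⟨hl x (List.mem_cons_of_mem _ hx), fun hx' => hnd.1 ?_⟩
        rw [← hx']
        exact List.mem_map_of_mem hx) (Γ.squareMoveWeight (cross d) wt) z
    have hm := h.squareMoveWeight hT hd wt
    rw [List.map_cons, List.map_cons, List.mem_cons, BipartiteMap.squareMovesWeight]
    constructor
    · intro hz
      by_cases hzl : G.edge z.dart ∈ l.map G.edge
      · rw [i1 hzl]
        -- The move at `d` leaves all weights over the edge of `z` untouched, because the edge of
        -- `d` does not occur again in the list.
        refine G.movedWeight_congr z fun y hy => (hm y).2 fun hy' => hnd.1 ?_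
        rwa [← hy', hy]
      · rw [i2 hzl, (hm z).1 (hz.resolve_right hzl)]
    · intro hz
      rw [not_or] at hz
      rw [i2 hz.2, (hm z).2 hz.1]

/-! ### Normal form of a weight and the remaining gauge freedom -/

/-- The weight on `G^□` with prescribed values on the sides of the squares and value `1` on the
edges joining squares. -/
def sideWeight {D : Type*} (x y : D → PosReal) : BoxEdge D → PosReal
  | cross d => x d
  | along d => y d
  | corner _ => 1

/-- A joining edge has weight `1` before and after, so the gauge values at its ends agree. Hence the
values at the white vertices determine the gauge: `g d` is the value at the white corner to the
right of `d`, and the black corner to the left of `d` carries `g (G.next d)`. -/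
theorem sideWeight_gaugeEquiv_iff {D : Type*} (G : TorusGraph D) (x y x' y' : D → PosReal) :
    G.box.GaugeEquiv (sideWeight x y) (sideWeight x' y') ↔ ∃ g : D → PosReal,
      ∀ d, x' d = x d * g d / g (G.next d) ∧ y' d = y d * g (G.rev d) / g (G.next d) := by
  rw [BipartiteMap.gaugeEquiv_iff]
  constructor
  · rintro ⟨p, q, hp, hq, h⟩
    have hp1 (d) : p (along d) = p (cross d) := hp (cross d)
    have hp2 (d) : p (cross d) = p (corner d) := hp (corner d)
    have hq1 (d) : q (cross (G.rev d)) = q (along d) := hq (along d)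
    have hq2 (d) : q (along (G.rev (G.next d))) = q (corner d) := hq (corner d)
    have hq3 (d) : q (cross (G.next d)) = q (corner d) := by
      rw [← hq2, ← hq1, G.rev_rev]
    have hc (d) : p (cross d) = q (cross (G.next d)) := by
      have : (1 : PosReal) = (p (corner d))⁻¹ * 1 * q (corner d) := h (corner d)
      rw [mul_one, eq_comm, inv_mul_eq_one] at this
      rw [hp2, this, hq3]
    refine ⟨fun d => q (cross d), fun d => ⟨?_, ?_⟩⟩
    · have := h (cross d)
      simp only [sideWeight] at this
      rw [this, hc, div_eq_mul_inv, mul_assoc, mul_comm]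
    · have := h (along d)
      simp only [sideWeight] at this
      rw [this, hp1, hc, ← hq1, div_eq_mul_inv, mul_assoc, mul_comm]
  · rintro ⟨g, hg⟩
    -- The white end of an edge lies to the right of `d`, `rev d` or `next d` according to its kind.
    -- Its black end always lies to the left of its dart.
    refine ⟨fun z => g (G.next z.dart), fun z => match z with
      | cross d => g d
      | along d => g (G.rev d)
      | corner d => g (G.next d), ?_, ?_, ?_⟩
    · rintro (d | d | d) <;> rfl
    · rintro (d | d | d)
      · exact congrArg g (G.next.apply_symm_apply d)
      · rfl
      · exact congrArg g (G.rev_rev _)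
    · rintro (d | d | d)
      · simp only [sideWeight, dart, (hg d).1, div_eq_mul_inv, mul_assoc]
        rw [← mul_assoc, mul_comm]
      · simp only [sideWeight, dart, (hg d).2, div_eq_mul_inv, mul_assoc]
        rw [← mul_assoc, mul_comm]
      · simp [sideWeight, dart]

/-- Each black vertex lies on exactly one joining edge, so a gauge at the black vertices alone
normalises all joining edges at once. -/
theorem exists_sideWeight {D : Type*} (G : TorusGraph D) (c : G.box.X) :
    ∃ x y : D → PosReal, c = G.box.weightClass (sideWeight x y) := by
  obtain ⟨wt, rfl⟩ := Quotient.exists_rep (s := G.box.gaugeSetoid) c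
  refine ⟨fun d => wt (cross d) / wt (corner d), fun d => wt (along d) / wt (corner d), ?_⟩
  refine (G.box.weightClass_eq_iff _ _).2 ((BipartiteMap.gaugeEquiv_iff _ _ _).2
    ⟨fun z => wt (corner z.dart), fun _ => 1, ?_, fun _ => rfl, ?_⟩)
  · rintro (d | d | d) <;> rfl
  · rintro (d | d | d) <;> simp [sideWeight, dart, div_eq_mul_inv, mul_comm]

/-! ### The fixed-point equation and its symmetric solutions -/

/-- The quantity `x x' + y y'` for the values `x, x'` and `y, y'` on opposite sides of a square. -/
def sideSum {D : Type*} (G : TorusGraph D) (x y : D → PosReal) (d : D) : PosReal :=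
  x d * x (G.rev d) + y d * y (G.rev d)

/-- The fixed-point equation `μ[wt] = [wt‾]` in terms of the weights of the sides. -/
theorem mu_eq_colorSwapX_iff {D : Type*} [DecidableEq D] (G : TorusGraph D) (l : List D)
    (hl : G.IsEdgeList l) (x y : D → PosReal) :
    G.mu l hl (G.box.weightClass (sideWeight x y)) =
        G.box.colorSwapX (G.box.weightClass (sideWeight x y)) ↔
      ∃ g : D → PosReal, ∀ d,
        x (G.rev d) / G.sideSum x y d = x d * g d / g (G.next d) ∧
        y (G.rev d) / G.sideSum x y d = y d * g (G.rev d) / g (G.next d) := by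
  -- The relabelling `cornerShift` fixes the sides and permutes only joining edges, all of weight
  -- `1`, so the moved weight is again in normal form.
  have hm : (fun z => G.box.squareMovesWeight (l.map cross) (sideWeight x y)
      (G.cornerShift.symm z)) = sideWeight (fun d => x (G.rev d) / G.sideSum x y d)
        (fun d => y (G.rev d) / G.sideSum x y d) := by
    have := fun z => (G.box_isStage.squareMovesWeight l (fun _ => Iff.rfl) hl.1
      (fun _ _ h => h) (sideWeight x y) z).1 (hl.2 _)
    funext z
    rw [this]
    rcases z with d | d | d <;>
      simp [cornerShift, movedWeight, sideWeight, squareSum, sideSum]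
  have h1 : G.mu l hl (G.box.weightClass (sideWeight x y)) =
      G.box.colorSwap.weightClass (fun z => G.box.squareMovesWeight (l.map cross)
        (sideWeight x y) (G.cornerShift.symm z)) := rfl
  have h2 : G.box.colorSwapX (G.box.weightClass (sideWeight x y)) =
      G.box.colorSwap.weightClass (sideWeight x y) := rfl
  -- `eq_comm` makes the gauge run from the original weight to the moved one.
  rw [h1, h2, hm, eq_comm, BipartiteMap.weightClass_eq_iff,
    BipartiteMap.colorSwap_gaugeEquiv_iff, sideWeight_gaugeEquiv_iff]

/-- A weight satisfying the fixed-point equation is gauge equivalent, by a square root of the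
gauge transformation in this equation, to one with equal weights on the two sides along every edge
and with `x² + y² = 1`. -/
theorem exists_gauge_symmetric {D : Type*} (G : TorusGraph D) (x y g : D → PosReal)
    (h : ∀ d, x (G.rev d) / G.sideSum x y d = x d * g d / g (G.next d) ∧
      y (G.rev d) / G.sideSum x y d = y d * g (G.rev d) / g (G.next d)) :
    ∃ x' y' : D → PosReal, G.box.GaugeEquiv (sideWeight x y) (sideWeight x' y') ∧
      (∀ d, y' (G.rev d) = y' d) ∧
      ∀ d, (x' d : ℝ) ^ 2 + (y' d : ℝ) ^ 2 = 1 := by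
  -- The gauge `g` leads from the weight to its moved version. Its square root stops halfway, at the
  -- geometric mean of the two.
  let k : D → PosReal := fun d => ⟨√(g d : ℝ), Real.sqrt_pos.2 (g d).2⟩
  have hk (d) : (g d : ℝ) = (k d : ℝ) ^ 2 := (Real.sq_sqrt (g d).2.le).symm
  let x' : D → PosReal := fun d => x d * k d / k (G.next d)
  let y' : D → PosReal := fun d => y d * k (G.rev d) / k (G.next d)
  have hx (d) : (x (G.rev d) : ℝ) / G.sideSum x y d =
      x d * (k d : ℝ) ^ 2 / (k (G.next d) : ℝ) ^ 2 := by
    rw [← hk, ← hk]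
    simpa [div_eq_mul_inv] using congrArg Subtype.val (h d).1
  have hy (d) : (y (G.rev d) : ℝ) / G.sideSum x y d =
      y d * (k (G.rev d) : ℝ) ^ 2 / (k (G.next d) : ℝ) ^ 2 := by
    rw [← hk, ← hk]
    simpa [div_eq_mul_inv] using congrArg Subtype.val (h d).2
  have hs (d) : G.sideSum x y (G.rev d) = G.sideSum x y d := by
    simp only [sideSum, G.rev_rev]
    rw [mul_comm (x d), mul_comm (y d)]
  have vx (d) : (x' d : ℝ) = x d * k d / k (G.next d) := by simp [x', div_eq_mul_inv]
  have vy (d) : (y' d : ℝ) = y d * k (G.rev d) / k (G.next d) := by simp [y', div_eq_mul_inv]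
  -- The equations at `d` and at `rev d` have the same denominator, by `hs`. The symmetry of `x'` is
  -- not needed separately, since it follows from that of `y'` and `x'² + y'² = 1`.
  have sy (d) : (y' (G.rev d) : ℝ) = y' d := by
    rw [vy, vy, G.rev_rev]
    have a := hy d
    have b := hy (G.rev d)
    rw [G.rev_rev, hs] at b
    exact mul_div_eq_of_div_eq_mul_sq_div (y d).2 (y _).2 (k _).2 (k _).2 (k _).2 (k _).2 a b
  refine ⟨x', y', (G.sideWeight_gaugeEquiv_iff _ _ _ _).2 ⟨k, fun d => ⟨rfl, rfl⟩⟩,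
    fun d => Subtype.ext (sy d), fun d => ?_⟩
  have a := hx d
  have b := hy d
  have hsum : (G.sideSum x y d : ℝ) = x d * x (G.rev d) + y d * y (G.rev d) := rfl
  have := (G.sideSum x y d).2.ne'
  -- The fixed-point equations turn `x'²` and `y'²` into products of opposite sides over `S`, and
  -- `S` is the sum of these products.
  calc (x' d : ℝ) ^ 2 + (y' d : ℝ) ^ 2 =
      (x d : ℝ) * (x d * (k d : ℝ) ^ 2 / (k (G.next d) : ℝ) ^ 2) +
        (y d : ℝ) * (y d * (k (G.rev d) : ℝ) ^ 2 / (k (G.next d) : ℝ) ^ 2) := by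
        rw [vx, vy]; ring
    _ = ((x d : ℝ) * x (G.rev d) + y d * y (G.rev d)) / G.sideSum x y d := by rw [← a, ← b]; ring
    _ = 1 := by rw [← hsum, div_self this]

/-! ### Ising weights as symmetric points of the unit circle -/

theorem isingWeight_eq_sideWeight {D : Type*} (G : TorusGraph D) (J : G.Edge → PosReal) :
    G.isingWeight J = sideWeight (fun d => G.isingWeight J (cross d))
      (fun d => G.isingWeight J (along d)) := by
  funext z
  rcases z with d | d | d <;> rfl

theorem isingWeight_rev {D : Type*} (G : TorusGraph D) (J : G.Edge → PosReal) (d : D) :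
    G.isingWeight J (cross (G.rev d)) = G.isingWeight J (cross d) ∧
    G.isingWeight J (along (G.rev d)) = G.isingWeight J (along d) := by
  simp only [isingWeight, G.edge_rev, and_self]

theorem isingWeight_sq_add_sq {D : Type*} (G : TorusGraph D) (J : G.Edge → PosReal) (d : D) :
    (G.isingWeight J (cross d) : ℝ) ^ 2 + (G.isingWeight J (along d) : ℝ) ^ 2 = 1 := by
  simp only [isingWeight, Real.tanh_eq_sinh_div_cosh]
  have h := Real.cosh_sq (2 * (J (G.edge d) : ℝ))
  have := (Real.cosh_pos (2 * (J (G.edge d) : ℝ))).ne'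
  field_simp
  linarith

/-- Since `x > 0`, the relation gives `0 < y < 1`, so `y = tanh(2J)` with `J > 0`. Then `x` is the
positive root of `1 - tanh²(2J)`, which is `sech(2J)`. -/
theorem exists_isingWeight_eq {D : Type*} (G : TorusGraph D) (x y : D → PosReal)
    (hy : ∀ d, y (G.rev d) = y d)
    (h : ∀ d, (x d : ℝ) ^ 2 + (y d : ℝ) ^ 2 = 1) :
    ∃ J : G.Edge → PosReal, G.isingWeight J = sideWeight x y := by
  have hlt (d) : (y d : ℝ) < 1 := by nlinarith [h d, (x d).2, (y d).2]
  -- The choice of a representative dart is harmless because `y` is symmetric under reversal.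
  let J : G.Edge → PosReal := fun ε => ⟨Real.artanh (y (Quotient.out ε)) / 2,
    half_pos (Real.artanh_pos ⟨(y _).2, hlt _⟩)⟩
  have hJ (d) : Real.tanh (2 * (J (G.edge d) : ℝ)) = y d := by
    have hd : y (Quotient.out (G.edge d)) = y d := by
      rcases (G.edge_eq_iff _ _).1 (Quotient.out_eq (G.edge d)) with e | e <;> rw [e]
      exact hy d
    change Real.tanh (2 * (Real.artanh (y (Quotient.out (G.edge d))) / 2)) = y d
    rw [hd, mul_div_cancel₀ _ two_ne_zero, Real.tanh_artanh]
    exact ⟨by linarith [(y d).2], hlt d⟩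
  have hal (d) : (G.isingWeight J (along d) : ℝ) = y d := hJ d
  refine ⟨J, funext ?_⟩
  rintro (d | d | d)
  · have h1 := G.isingWeight_sq_add_sq J d
    rw [hal, ← h d, add_left_inj, sq_eq_sq₀ (G.isingWeight J _).2.le (x d).2.le] at h1
    exact Subtype.ext h1
  · exact Subtype.ext (hal d)
  · rfl

/-! ### Injectivity and the image -/

/-- Ising weights agree at `d` and `rev d`, so the gauge relations at these two darts describe the
same pair of numbers twice. This overdetermination fixes `tanh(2J)`, and `tanh` is injective. -/
theorem isingClass_injective {D : Type*} (G : TorusGraph D) :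
    Function.Injective G.isingClass := by
  intro J J' hJ
  have hJ := (G.box.weightClass_eq_iff _ _).1 hJ
  rw [G.isingWeight_eq_sideWeight J, G.isingWeight_eq_sideWeight J',
    sideWeight_gaugeEquiv_iff] at hJ
  obtain ⟨g, hg⟩ := hJ
  funext ε
  obtain ⟨d, rfl⟩ : ∃ d, G.edge d = ε := Quotient.exists_rep ε
  obtain ⟨a1, a2⟩ := hg d
  obtain ⟨b1, b2⟩ := hg (G.rev d)
  rw [(G.isingWeight_rev J d).1, (G.isingWeight_rev J' d).1] at b1
  rw [(G.isingWeight_rev J d).2, (G.isingWeight_rev J' d).2, G.rev_rev] at b2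
  have s := G.isingWeight_sq_add_sq J d
  have s' := G.isingWeight_sq_add_sq J' d
  have key : G.isingWeight J' (along d) = G.isingWeight J (along d) := by
    have val {a b p q : PosReal} (h : a = b * p / q) : (a : ℝ) = b * p / q := by
      simpa [div_eq_mul_inv] using congrArg Subtype.val h
    exact Subtype.ext (eq_of_symmetric_rescaling (G.isingWeight J _).2 (G.isingWeight J _).2
      (g _).2 (g _).2 (g _).2 (g _).2 (val a1) (val b1) (val a2) (val b2)
      s s')
  have key : Real.tanh (2 * (J' (G.edge d) : ℝ)) = Real.tanh (2 * (J (G.edge d) : ℝ)) :=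
    congrArg Subtype.val key
  have := Real.tanh_injective key
  exact Subtype.ext (by linarith)

/-- Opposite sides agree and `sech² + tanh² = 1`, so the closed form returns the same weights and
the trivial gauge suffices. -/
theorem mu_isingClass {D : Type*} [DecidableEq D] (G : TorusGraph D) (l : List D)
    (hl : G.IsEdgeList l) (J : G.Edge → PosReal) :
    G.mu l hl (G.isingClass J) = G.box.colorSwapX (G.isingClass J) := by
  rw [isingClass, isingWeight_eq_sideWeight, mu_eq_colorSwapX_iff]
  refine ⟨fun _ => 1, fun d => ?_⟩
  have hs : G.sideSum (fun d => G.isingWeight J (cross d))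
      (fun d => G.isingWeight J (along d)) d = 1 := by
    refine Subtype.ext ?_
    simp only [sideSum, G.isingWeight_rev]
    simpa [sq] using G.isingWeight_sq_add_sq J d
  simp [hs, G.isingWeight_rev]

end TorusGraph

theorem theorem4p1 {D : Type*} [DecidableEq D] (G : TorusGraph D) (l : List D)
    (hl : G.IsEdgeList l) :
    Function.Injective G.isingClass ∧
      Set.range G.isingClass = {x : G.box.X | G.mu l hl x = G.box.colorSwapX x} := by
  refine ⟨G.isingClass_injective, Set.Subset.antisymm ?_ ?_⟩
  · rintro _ ⟨J, rfl⟩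
    exact G.mu_isingClass l hl J
  · intro c hc
    obtain ⟨x, y, rfl⟩ := G.exists_sideWeight c
    obtain ⟨g, hg⟩ := (G.mu_eq_colorSwapX_iff l hl x y).1 hc
    obtain ⟨x', y', hgauge, hy, h⟩ := G.exists_gauge_symmetric x y g hg
    obtain ⟨J, hJ⟩ := G.exists_isingWeight_eq x' y' hy h
    refine ⟨J, ?_⟩
    rw [TorusGraph.isingClass, hJ]
    exact ((G.box.weightClass_eq_iff _ _).2 hgauge).symm
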